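/- Let $G\subseteq\mathbb R$ be a $G_\delta$ set and let $\mathcal C_G$ be the set of all functions $f:\mathbb R\to\mathbb R$ whose set of continuity points equals $G$. Let $U$ be the union of all open sets $I\subseteq\mathbb R$ such that $(\mathbb R\setminus G)\cap I$ is nonempty and countable (finite or infinite). Assume that $U\setminus G$ is nonempty and discrete (every point of $U\setminus G$ is isolated in $U\setminus G$). Then $\mathcal C_G$ is strongly $\mathfrak c$-algebrable in the real algebra $\mathbb R^{\mathbb R}$ with pointwise operations: there is a set $X\subseteq\mathbb R^{\mathbb R}$ of cardinality $\mathfrak c$ such that $P(x_1,\dots,x_n)\neq 0$ for all $n\ge 1$, all distinct $x_1,\dots,x_n\in X$ and every nonzero real polynomial $P$ in $n$ variables without constant term, and such that the (not necessarily unital) subalgebra of $\mathbb R^{\mathbb R}$ generated by $X$, which is thus free on $X$, is contained in $\mathcal C_G\cup\{0\}$. -/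

import Mathlib

/-- `X` is a set of free generators of the (non-unital) commutative `K`-algebra that it generates:
no nonzero polynomial without constant term vanishes on `X`. Equivalently, the evaluation map from
the free commutative non-unital `K`-algebra on `X`, that is, from the polynomials in the variables
`X` without constant term, to `A` is injective. -/
def IsFreeGenerating (K : Type*) {A : Type*} [Field K] [CommRing A] [Algebra K A]
    (X : Set A) : Prop :=
  ∀ P : MvPolynomial X K, MvPolynomial.constantCoeff P = 0 →
    MvPolynomial.aeval (fun x : X => (x : A)) P = 0 → P = 0

/-- `E` is strongly `κ`-algebrable: `E ∪ {0}` contains a (non-unital) subalgebra `B` of `A` that is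
free with a set of free generators of cardinality `κ`. -/
def StronglyAlgebrable (K : Type*) {A : Type*} [Field K] [CommRing A] [Algebra K A]
    (κ : Cardinal) (E : Set A) : Prop :=
  ∃ B : NonUnitalSubalgebra K A, (B : Set A) ⊆ E ∪ {0} ∧
    ∃ X : Set A, Cardinal.mk X = κ ∧ NonUnitalAlgebra.adjoin K X = B ∧ IsFreeGenerating K X

/-- The functions `ℝ → ℝ` whose set of continuity points is exactly `G`. -/
def continuityClass (G : Set ℝ) : Set (ℝ → ℝ) :=
  {f | {x | ContinuousAt f x} = G}

/-- The union of all open sets that meet `ℝ ∖ G` in a nonempty countable set. -/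
def countableTraceUnion (G : Set ℝ) : Set ℝ :=
  ⋃₀ {I | IsOpen I ∧ (Gᶜ ∩ I).Nonempty ∧ (Gᶜ ∩ I).Countable}

open Filter Topology Set

/-! Let `U` be `countableTraceUnion G`. Then `Gᶜ` splits into the countable set `A = U \ G` and the
`Fσ` set `E = Gᶜ \ U`, each of whose points is a condensation point of `E`; write `E` as a union of
perfect sets `F k`. The generators are `∑ δ a * H α (1 / |x - a|) + rankWeight F x * H α (ψ x)`,
where the values of `H α` at the integers cluster jointly at every point of the cube `[0, 1]^ℝ` and
every colour of `ψ` is dense in each `F k`. Dominated convergence and the decay of `rankWeight` give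
continuity on `G`. Near a point of `Gᶜ` the joint values of the generators cluster on a whole cube,
so a polynomial in them that is continuous there is constant (`eq_C_of_continuousAt_eval`). This
yields both freeness and discontinuity off `G`. -/

/-! ### A continuum of sequences in `[0, 1]` clustering at every point of the cube -/

/-- The continuous functions are dense in the space of all functions `ℝ → ℝ` with the topology of
pointwise convergence. -/
theorem denseRange_coe_continuousMap :
    DenseRange (fun g : C(ℝ, ℝ) => (g : ℝ → ℝ)) := by
  intro y
  rw [mem_closure_iff_nhds]
  intro s hs
  rw [nhds_pi, Filter.mem_pi] at hs
  obtain ⟨I, hI, t, ht, hts⟩ := hs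
  let p := Lagrange.interpolate hI.toFinset id y
  refine ⟨fun x => p.eval x, hts fun i hi => ?_, ⟨⟨_, p.continuous⟩, rfl⟩⟩
  have : p.eval i = y i :=
    Lagrange.eval_interpolate_at_node (v := id) y (injOn_id _) (hI.mem_toFinset.2 hi)
  simpa only [this] using mem_of_mem_nhds (ht i)

/-- A sequence of functions `ℝ → [0, 1]` for which every function `ℝ → [0, 1]` is a cluster point
with respect to pointwise convergence. -/
theorem exists_seq_mapClusterPt_cube :
    ∃ h : ℕ → ℝ → ℝ, (∀ n α, h n α ∈ Icc (0 : ℝ) 1) ∧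
      ∀ y : ℝ → ℝ, (∀ α, y α ∈ Icc (0 : ℝ) 1) → MapClusterPt y atTop h := by
  let q : ℕ → ℝ → ℝ := fun n => TopologicalSpace.denseSeq C(ℝ, ℝ) n
  have hq : DenseRange q :=
    denseRange_coe_continuousMap.comp (TopologicalSpace.denseRange_denseSeq C(ℝ, ℝ))
      (continuous_pi fun x => continuous_eval_const x)
  let c : (ℝ → ℝ) → ℝ → ℝ := fun y α => max 0 (min 1 (y α))
  have hc : Continuous c := by fun_prop
  -- `n.unpair.1` takes each value infinitely often, which turns density of the range of `q` into
  -- clustering; `c` clips to `[0, 1]`.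
  refine ⟨c ∘ fun n => q n.unpair.1, fun n α => ?_, fun y hy => ?_⟩
  · simp [c]
  · have hcy : c y = y := by
      ext α
      simp [c, (hy α).1, (hy α).2]
    have key : MapClusterPt y atTop fun n : ℕ => q n.unpair.1 := by
      rw [mapClusterPt_iff_frequently]
      intro s hs
      rw [frequently_atTop]
      intro N
      obtain ⟨_, hks, k, rfl⟩ := mem_closure_iff_nhds.1 (hq y) s hs
      exact ⟨Nat.pair k N, Nat.right_le_pair k N, by simpa using hks⟩
    have := key.continuousAt_comp hc.continuousAt
    rwa [hcy] at this

/-- Continuous functions `H α : ℝ → [0, 1]` whose values at the natural numbers cluster jointly at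
every point of the cube. -/
theorem exists_continuous_mapClusterPt_cube :
    ∃ H : ℝ → ℝ → ℝ, (∀ α, Continuous (H α)) ∧ (∀ α t, H α t ∈ Icc (0 : ℝ) 1) ∧
      ∀ y : ℝ → ℝ, (∀ α, y α ∈ Icc (0 : ℝ) 1) →
        MapClusterPt y atTop fun (n : ℕ) α => H α n := by
  obtain ⟨h, h01, hcl⟩ := exists_seq_mapClusterPt_cube
  have ext (α : ℝ) : ∃ g : C(ℝ, ℝ), (∀ t, g t ∈ Icc (0 : ℝ) 1) ∧ ∀ n : ℕ, g n = h n α := by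
    obtain ⟨g, hg, hgh⟩ := ContinuousMap.exists_extension_forall_mem_of_isClosedEmbedding
      (⟨fun n => h n α, continuous_of_discreteTopology⟩ : C(ℕ, ℝ)) (t := Icc (0 : ℝ) 1)
      (fun n => h01 n α) ⟨0, by simp⟩ Nat.isClosedEmbedding_coe_real
    exact ⟨g, hg, fun n => congrFun hgh n⟩
  choose g hg hgh using ext
  refine ⟨fun α => g α, fun α => (g α).continuous, hg, fun y hy => ?_⟩
  simpa only [hgh] using hcl y hy

/-- If along a sequence converging to `x` the functions `F · α` are of the form
`(convergent) + δ * h n α` with `h` clustering everywhere in the cube, then a polynomial in the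
`F · α` which is continuous at `x` is constant. -/
theorem eq_C_of_continuousAt_eval {ι X : Type*} [TopologicalSpace X] {F : X → ι → ℝ} {x : X}
    {h : ℕ → ι → ℝ}
    (hcl : ∀ y : ι → ℝ, (∀ α, y α ∈ Icc (0 : ℝ) 1) → MapClusterPt y atTop h)
    {u : ℕ → X} (hu : Tendsto u atTop (𝓝 x)) {G : ℕ → ι → ℝ} {g : ι → ℝ}
    (hG : Tendsto G atTop (𝓝 g)) {δ : ℝ} (hδ : 0 < δ)
    (hF : ∀ n α, F (u n) α = G n α + δ * h n α)
    (P : MvPolynomial ι ℝ) (hP : ContinuousAt (fun z => MvPolynomial.eval (F z) P) x) :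
    P = MvPolynomial.C (MvPolynomial.eval (F x) P) := by
  have hval (y : ι → ℝ) (hy : ∀ α, y α ∈ Icc (0 : ℝ) 1) :
      MvPolynomial.eval (g + δ • y) P = MvPolynomial.eval (F x) P := by
    obtain ⟨U, hU, hUy⟩ := mapClusterPt_iff_ultrafilter.1 (hcl y hy)
    have h1 : Tendsto (fun n => MvPolynomial.eval (F (u n)) P) U
        (𝓝 (MvPolynomial.eval (F x) P)) := hP.tendsto.comp (hu.mono_left hU)
    have h2 : Tendsto (fun n => F (u n)) U (𝓝 (g + δ • y)) := by
      have : (fun n => F (u n)) = fun n => G n + δ • h n := by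
        ext n α
        simp [hF]
      rw [this]
      exact (hG.mono_left hU).add (hUy.const_smul δ)
    exact tendsto_nhds_unique (((MvPolynomial.continuous_eval P).tendsto _).comp h2) h1
  -- `P` is constant on a box with infinite sides, and this determines it.
  refine MvPolynomial.funext_set (fun α => Icc (g α) (g α + δ))
    (fun α => Icc_infinite (by linarith)) fun z hz => ?_
  have hz' (α : ι) : g α ≤ z α ∧ z α ≤ g α + δ := hz α (mem_univ α)
  have := hval (fun α => (z α - g α) / δ) fun α =>
    ⟨div_nonneg (by linarith [hz' α]) hδ.le, by rw [div_le_one hδ]; linarith [hz' α]⟩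
  rw [MvPolynomial.eval_C, ← this]
  congr 2
  ext α
  simp only [Pi.add_apply, Pi.smul_apply, smul_eq_mul]
  field_simp
  ring

/-! ### Decomposition into perfect sets -/

/-- Every ball about `s` meets some `C k` in an uncountable set, hence contains a nonempty perfect
subset of `E`. Such sets shrinking to `s` accumulate only at `s` outside their union. -/
theorem exists_perfect_mem_of_condensation {E : Set ℝ} {C : ℕ → Set ℝ}
    (hC : ∀ k, IsClosed (C k)) (hE : E = ⋃ k, C k)
    (hcond : ∀ x ∈ E, ∀ V ∈ 𝓝 x, ¬ (E ∩ V).Countable) {s : ℝ} (hs : s ∈ E) :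
    ∃ K, Perfect K ∧ s ∈ K ∧ K ⊆ E := by
  have hD (j : ℕ) : ∃ D, Perfect D ∧ D.Nonempty ∧
      D ⊆ E ∩ Metric.closedBall s (1 / ((j : ℝ) + 1)) := by
    have h1 := hcond s hs _ (Metric.closedBall_mem_nhds s (Nat.one_div_pos_of_nat (n := j)))
    obtain ⟨k, hk⟩ : ∃ k, ¬ (C k ∩ Metric.closedBall s (1 / ((j : ℝ) + 1))).Countable := by
      by_contra! hcon
      refine h1 ?_
      rw [hE, iUnion_inter]
      exact countable_iUnion hcon
    obtain ⟨D, hD, hne, hDC⟩ := exists_perfect_nonempty_of_isClosed_of_not_countable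
      ((hC k).inter Metric.isClosed_closedBall) hk
    exact ⟨D, hD, hne, hDC.trans (inter_subset_inter_left _ (hE ▸ subset_iUnion C k))⟩
  choose D hDp hDne hDE using hD
  refine ⟨{s} ∪ ⋃ j, D j, ⟨?_, ?_⟩, by simp, ?_⟩
  · have : {s} ∪ ⋃ j, D j = ⋂ N : ℕ,
        (({s} ∪ ⋃ j ∈ Finset.range N, D j) ∪ Metric.closedBall s (1 / ((N : ℝ) + 1))) := by
      ext x
      simp only [mem_union, mem_singleton_iff, mem_iUnion, mem_iInter, Finset.mem_range,
        exists_prop]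
      constructor
      · rintro (rfl | ⟨j, hj⟩) N
        · exact Or.inl (Or.inl rfl)
        · rcases lt_or_ge j N with hjN | hNj
          · exact Or.inl (Or.inr ⟨j, hjN, hj⟩)
          · exact Or.inr (Metric.closedBall_subset_closedBall
              (Nat.one_div_le_one_div hNj) (hDE j hj).2)
      · intro h
        by_contra! hcon
        obtain ⟨N, hN⟩ := exists_nat_one_div_lt (dist_pos.2 hcon.1)
        rcases h N with (h | ⟨j, -, hj⟩) | h
        · exact hcon.1 h
        · exact hcon.2 j hj
        · exact absurd (Metric.mem_closedBall.1 h) (not_le.2 hN)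
    rw [this]
    exact isClosed_iInter fun N => (isClosed_singleton.union
      (isClosed_biUnion_finset fun j _ => (hDp j).closed)).union Metric.isClosed_closedBall
  · have hacc (j : ℕ) (x : ℝ) (hx : x ∈ D j) : AccPt x (𝓟 ({s} ∪ ⋃ j, D j)) :=
      ((hDp j).acc x hx).mono
        (principal_mono.2 ((subset_iUnion D j).trans subset_union_right))
    rintro x (rfl | hx)
    · by_cases hxD : ∃ j, x ∈ D j
      · exact hacc _ x hxD.choose_spec
      rw [accPt_iff_nhds]
      intro U hU
      obtain ⟨ε, hε, hεU⟩ := Metric.mem_nhds_iff.1 hU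
      obtain ⟨N, hN⟩ := exists_nat_one_div_lt hε
      obtain ⟨y, hy⟩ := hDne N
      refine ⟨y, ⟨hεU ?_, Or.inr (mem_iUnion.2 ⟨N, hy⟩)⟩, ?_⟩
      · exact (Metric.mem_closedBall.1 (hDE N hy).2).trans_lt hN
      · rintro rfl
        exact hxD ⟨N, hy⟩
    · obtain ⟨j, hj⟩ := mem_iUnion.1 hx
      exact hacc j x hj
  · exact union_subset (singleton_subset_iff.2 hs)
      (iUnion_subset fun j => (hDE j).trans inter_subset_left)

/-- An `Fσ` set all of whose points are condensation points is a countable union of perfect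
sets. -/
theorem exists_iUnion_perfect_of_condensation {E : Set ℝ} {C : ℕ → Set ℝ}
    (hC : ∀ k, IsClosed (C k)) (hE : E = ⋃ k, C k)
    (hcond : ∀ x ∈ E, ∀ V ∈ 𝓝 x, ¬ (E ∩ V).Countable) :
    ∃ F : ℕ → Set ℝ, (∀ k, Perfect (F k)) ∧ ⋃ k, F k = E := by
  choose V D hV hD hVD using fun k => exists_countable_union_perfect_of_isClosed (hC k)
  have hVE : ⋃ k, V k ⊆ E := by
    rw [hE]
    exact iUnion_mono fun k => (hVD k) ▸ subset_union_left
  have hDE : ⋃ k, D k ⊆ E := by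
    rw [hE]
    exact iUnion_mono fun k => (hVD k) ▸ subset_union_right
  choose K hKp hsK hKE using fun s : ⋃ k, V k =>
    exists_perfect_mem_of_condensation hC hE hcond (hVE s.2)
  have : Countable (⋃ k, V k) := (countable_iUnion hV).to_subtype
  -- The summand `ℕ` indexes the perfect kernels `D`; the other indexes perfect sets through the
  -- countably many leftover points.
  obtain ⟨e, he⟩ := exists_surjective_nat (ℕ ⊕ (⋃ k, V k))
  refine ⟨fun n => Sum.elim D K (e n), fun n => ?_, ?_⟩
  · change Perfect (Sum.elim D K (e n))
    rcases e n with k | s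
    · exact hD k
    · exact hKp s
  · rw [he.iUnion_comp (Sum.elim D K), iUnion_sum]
    refine Subset.antisymm (union_subset hDE (iUnion_subset hKE)) fun x hx => ?_
    rw [hE] at hx
    obtain ⟨k, hk⟩ := mem_iUnion.1 hx
    rw [hVD k] at hk
    rcases hk with hk | hk
    · exact Or.inr (mem_iUnion.2 ⟨⟨x, mem_iUnion.2 ⟨k, hk⟩⟩, hsK _⟩)
    · exact Or.inl (mem_iUnion.2 ⟨k, hk⟩)

/-- Countably many infinite sets have an injective choice function. -/
theorem exists_injective_mem_of_infinite {ι α : Type*} [Countable ι] {S : ι → Set α}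
    (hS : ∀ i, (S i).Infinite) : ∃ c : ι → α, Function.Injective c ∧ ∀ i, c i ∈ S i := by
  classical
  obtain ⟨e, he⟩ := exists_injective_nat ι
  choose t htS htc using fun i => (hS i).exists_subset_card_eq (e i + 1)
  -- Hall's condition: the member of `s` with the largest code `e i` alone supplies `e i + 1 ≥
  -- s.card` elements.
  obtain ⟨c, hc, hct⟩ := (Finset.all_card_le_biUnion_card_iff_exists_injective t).1 fun s => by
    rcases s.eq_empty_or_nonempty with rfl | hs
    · simp
    obtain ⟨i, hi, hmax⟩ := s.exists_max_image e hs
    calc s.card = (s.image e).card := (Finset.card_image_of_injective s he).symm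
      _ ≤ (Finset.range (e i + 1)).card := Finset.card_le_card fun n hn => by
        obtain ⟨j, hj, rfl⟩ := Finset.mem_image.1 hn
        exact Finset.mem_range.2 (Nat.lt_succ_of_le (hmax j hj))
      _ = (t i).card := by rw [Finset.card_range, htc]
      _ ≤ (s.biUnion t).card := Finset.card_le_card (Finset.subset_biUnion_of_mem t hi)
  exact ⟨c, hc, fun i => htS i (hct i)⟩

/-- A colouring of the line with countably many colours, each of which is dense in each of
countably many given preperfect sets. -/
theorem exists_coloring_of_preperfect {F : ℕ → Set ℝ} (hF : ∀ k, Preperfect (F k)) :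
    ∃ ψ : ℝ → ℕ, ∀ k, ∀ x ∈ F k, ∀ V ∈ 𝓝 x, ∀ m, ∃ y ∈ F k ∩ V, ψ y = m := by
  let B := TopologicalSpace.countableBasis ℝ
  have hB : TopologicalSpace.IsTopologicalBasis B := TopologicalSpace.isBasis_countableBasis ℝ
  have : Countable B := (TopologicalSpace.countable_countableBasis ℝ).to_subtype
  let J := {p : ℕ × B × ℕ // (F p.1 ∩ p.2.1).Nonempty}
  have hinf (p : J) : (F p.1.1 ∩ p.1.2.1).Infinite := by
    obtain ⟨x, hxF, hxB⟩ := p.2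
    have h1 := (hF p.1.1 x hxF).nhds_inter ((hB.isOpen p.1.2.1.2).mem_nhds hxB)
    rw [inter_comm] at h1
    exact Set.Infinite.of_accPt h1
  obtain ⟨c, hc, hcS⟩ := exists_injective_mem_of_infinite hinf
  -- Each triple (set, basic open set, colour) owns its point `c p`, so the prescribed colours never
  -- conflict; all other points get colour `0`.
  refine ⟨Function.extend c (fun p => p.1.2.2) 0, fun k x hx V hV m => ?_⟩
  obtain ⟨b, hb, hxb, hbV⟩ := hB.mem_nhds_iff.1 hV
  let p : J := ⟨(k, ⟨b, hb⟩, m), ⟨x, hx, hxb⟩⟩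
  exact ⟨c p, ⟨(hcS p).1, hbV (hcS p).2⟩, hc.extend_apply _ _ p⟩

/-! ### The generators -/

/-- The reciprocal of one plus the first index `k` with `x ∈ F k`, and `0` if there is none. -/
noncomputable def rankWeight (F : ℕ → Set ℝ) (x : ℝ) : ℝ :=
  open Classical in if h : ∃ k, x ∈ F k then 1 / ((Nat.find h : ℝ) + 1) else 0

theorem rankWeight_nonneg (F : ℕ → Set ℝ) (x : ℝ) : 0 ≤ rankWeight F x := by
  unfold rankWeight
  split_ifs
  · positivity
  · exact le_rfl

theorem rankWeight_eq {F : ℕ → Set ℝ} {x : ℝ} {n : ℕ} (hx : x ∈ F n)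
    (hlt : ∀ k < n, x ∉ F k) : rankWeight F x = 1 / ((n : ℝ) + 1) := by
  classical
  have h : ∃ k, x ∈ F k := ⟨n, hx⟩
  have hn : Nat.find h = n := (Nat.find_eq_iff h).2 ⟨hx, hlt⟩
  rw [rankWeight, dif_pos h, ← hn]

theorem rankWeight_le {F : ℕ → Set ℝ} {x : ℝ} {n : ℕ} (hlt : ∀ k < n, x ∉ F k) :
    rankWeight F x ≤ 1 / ((n : ℝ) + 1) := by
  classical
  by_cases h : ∃ k, x ∈ F k
  · rw [rankWeight, dif_pos h]
    exact Nat.one_div_le_one_div ((Nat.le_find_iff h n).2 hlt)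
  · rw [rankWeight, dif_neg h]
    positivity

theorem eventually_forall_lt_notMem {F : ℕ → Set ℝ} (hF : ∀ k, IsClosed (F k)) {x : ℝ} {n : ℕ}
    (hx : ∀ k < n, x ∉ F k) : ∀ᶠ y in 𝓝 x, ∀ k < n, y ∉ F k :=
  (eventually_all_finite (finite_lt_nat n)).2 fun k hk => (hF k).isOpen_compl.mem_nhds (hx k hk)

theorem tendsto_rankWeight {F : ℕ → Set ℝ} (hF : ∀ k, IsClosed (F k)) {x : ℝ}
    (hx : x ∉ ⋃ k, F k) : Tendsto (rankWeight F) (𝓝 x) (𝓝 0) := by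
  rw [Metric.tendsto_nhds]
  intro ε hε
  obtain ⟨N, hN⟩ := exists_nat_one_div_lt hε
  have hx' : ∀ k < N, x ∉ F k := fun k _ hk => hx (mem_iUnion.2 ⟨k, hk⟩)
  filter_upwards [eventually_forall_lt_notMem hF hx'] with y hy
  rw [Real.dist_0_eq_abs, abs_of_nonneg (rankWeight_nonneg F y)]
  exact (rankWeight_le hy).trans_lt hN

/-- The function `x ↦ ∑ δ a * H (1 / |x - a|)` (sum over `a ∈ A`), oscillating at the points
of `A`. -/
noncomputable def oscSum (A : Set ℝ) (δ : ℝ → ℝ) (H : ℝ → ℝ) (x : ℝ) : ℝ :=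
  ∑' a : A, δ a * H (1 / |x - a|)

section oscSum

variable {A : Set ℝ} {δ : ℝ → ℝ} {H : ℝ → ℝ}

theorem norm_oscSum_term_le (hδ : ∀ a, 0 < δ a) (h01 : ∀ t, H t ∈ Icc (0 : ℝ) 1) (a t : ℝ) :
    ‖δ a * H t‖ ≤ δ a := by
  rw [Real.norm_eq_abs, abs_of_nonneg (mul_nonneg (hδ a).le (h01 t).1)]
  exact mul_le_of_le_one_right (hδ a).le (h01 t).2

theorem continuousAt_oscSum_term (hH : Continuous H) {a x : ℝ} (hax : x ≠ a) :
    ContinuousAt (fun y => δ a * H (1 / |y - a|)) x := by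
  have h : |x - a| ≠ 0 := abs_ne_zero.2 (sub_ne_zero.2 hax)
  refine continuousAt_const.mul (hH.continuousAt.comp (f := fun y => 1 / |y - a|) ?_)
  exact continuousAt_const.div (by fun_prop) h

theorem continuousAt_oscSum (hδ : ∀ a, 0 < δ a) (hs : Summable fun a : A => δ a)
    (hH : Continuous H) (h01 : ∀ t, H t ∈ Icc (0 : ℝ) 1) {x : ℝ} (hx : x ∉ A) :
    ContinuousAt (oscSum A δ H) x :=
  tendsto_tsum_of_dominated_convergence hs
    (fun a => continuousAt_oscSum_term hH fun h => hx (h ▸ a.2))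
    (Eventually.of_forall fun _ a => norm_oscSum_term_le hδ h01 a _)

theorem summable_coe_of_subset {B : Set ℝ} (hs : Summable fun a : A => δ a) (hB : B ⊆ A) :
    Summable fun b : B => δ b :=
  Summable.comp_injective (i := inclusion hB) hs (inclusion_injective hB)

theorem tsum_eq_tsum_diff_singleton_add {φ : ℝ → ℝ} (hφ : Summable fun b : A => φ b) {a : ℝ}
    (ha : a ∈ A) : ∑' b : A, φ b = ∑' b : (A \ {a} : Set ℝ), φ b + φ a := by
  have hA : (A \ {a}) ∪ {a} = A := by simp [ha]
  have h := (summable_coe_of_subset hφ (sdiff_subset (t := {a}))).tsum_union_disjoint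
    disjoint_sdiff_left (summable_coe_of_subset hφ (singleton_subset_iff.2 ha))
  rwa [hA, tsum_singleton] at h

/-- Isolates the one term that oscillates at `a`; the remaining sum is continuous there. -/
theorem oscSum_eq_add (hδ : ∀ a, 0 < δ a) (hs : Summable fun a : A => δ a)
    (h01 : ∀ t, H t ∈ Icc (0 : ℝ) 1) {a : ℝ} (ha : a ∈ A) (x : ℝ) :
    oscSum A δ H x = oscSum (A \ {a}) δ H x + δ a * H (1 / |x - a|) := by
  have hsum : Summable fun b : A => δ b * H (1 / |x - b|) :=
    Summable.of_norm_bounded hs fun b => norm_oscSum_term_le hδ h01 b _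
  unfold oscSum
  exact tsum_eq_tsum_diff_singleton_add (φ := fun b => δ b * H (1 / |x - b|)) hsum ha

end oscSum

/-- If `A` is countable and `E` is an `Fσ` set all of whose points are condensation points of `E`,
disjoint from `A`, there is a family of functions continuous off `A ∪ E` such that no nonconstant
polynomial in the family is continuous at a point of `A ∪ E`. -/
theorem exists_family_polynomial_discontinuous {A E : Set ℝ} (hA : A.Countable)
    {C : ℕ → Set ℝ} (hC : ∀ k, IsClosed (C k)) (hE : E = ⋃ k, C k)
    (hcond : ∀ x ∈ E, ∀ V ∈ 𝓝 x, ¬ (E ∩ V).Countable) (hAE : Disjoint A E) :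
    ∃ f : ℝ → ℝ → ℝ, (∀ α, ∀ x ∉ A ∪ E, ContinuousAt (f α) x) ∧
      ∀ x ∈ A ∪ E, ∀ P : MvPolynomial ℝ ℝ,
        ContinuousAt (fun z => MvPolynomial.eval (fun α => f α z) P) x →
          P = MvPolynomial.C (MvPolynomial.eval (fun α => f α x) P) := by
  obtain ⟨H, hH, h01, hcl⟩ := exists_continuous_mapClusterPt_cube
  obtain ⟨F, hFp, hFE⟩ := exists_iUnion_perfect_of_condensation hC hE hcond
  obtain ⟨ψ, hψ⟩ := exists_coloring_of_preperfect fun k => (hFp k).acc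
  obtain ⟨δ, hδ, c, hc, -⟩ := hA.exists_pos_hasSum_le one_pos
  have hs : Summable fun a : A => δ a := hc.summable
  have hcontA (α x : ℝ) (hx : x ∉ A) : ContinuousAt (oscSum A δ (H α)) x :=
    continuousAt_oscSum hδ hs (hH α) (h01 α) hx
  have hcontE (α x : ℝ) (hx : x ∉ E) :
      ContinuousAt (fun z => rankWeight F z * H α (ψ z)) x := by
    have hw := tendsto_rankWeight (fun k => (hFp k).closed) (hFE.symm ▸ hx)
    have hwx : rankWeight F x = 0 := by
      rw [rankWeight, dif_neg]
      rintro ⟨k, hk⟩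
      exact hx (hFE ▸ mem_iUnion.2 ⟨k, hk⟩)
    rw [ContinuousAt, hwx, zero_mul]
    exact squeeze_zero (fun z => mul_nonneg (rankWeight_nonneg F z) (h01 α _).1)
      (fun z => mul_le_of_le_one_right (rankWeight_nonneg F z) (h01 α _).2) hw
  refine ⟨fun α x => oscSum A δ (H α) x + rankWeight F x * H α (ψ x), fun α x hx =>
    (hcontA α x fun h => hx (Or.inl h)).add (hcontE α x fun h => hx (Or.inr h)), ?_⟩
  rintro x (hx | hx) P hP
  · have hxE : x ∉ E := disjoint_left.1 hAE hx
    have hu : Tendsto (fun n : ℕ => x + 1 / (n : ℝ)) atTop (𝓝 x) := by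
      simpa using tendsto_one_div_atTop_nhds_zero_nat.const_add x
    refine eq_C_of_continuousAt_eval
      (F := fun z α => oscSum A δ (H α) z + rankWeight F z * H α (ψ z))
      (δ := δ x) hcl hu
      (G := fun n α => oscSum (A \ {x}) δ (H α) (x + 1 / (n : ℝ)) +
        rankWeight F (x + 1 / (n : ℝ)) * H α (ψ (x + 1 / (n : ℝ))))
      (g := fun α => oscSum (A \ {x}) δ (H α) x + rankWeight F x * H α (ψ x))
      (tendsto_pi_nhds.2 fun α => ?_) (hδ x) (fun n α => ?_) P hP
    · have hosc : ContinuousAt (oscSum (A \ {x}) δ (H α)) x :=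
        continuousAt_oscSum hδ (summable_coe_of_subset hs sdiff_subset) (hH α) (h01 α) (by simp)
      exact (hosc.tendsto.comp hu).add ((hcontE α x hxE).tendsto.comp hu)
    -- This includes `n = 0`, since `1 / 0 = 0`.
    · have : 1 / |x + 1 / (n : ℝ) - x| = n := by simp
      rw [oscSum_eq_add hδ hs (h01 α) hx, this]
      ring
  · have hxA : x ∉ A := disjoint_right.1 hAE hx
    have hex : ∃ k, x ∈ F k := mem_iUnion.1 (hFE.symm ▸ hx)
    classical
    let n := Nat.find hex
    have hn : x ∈ F n := Nat.find_spec hex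
    have hmin : ∀ k < n, x ∉ F k := fun k hk => Nat.find_min hex hk
    have hev := eventually_forall_lt_notMem (fun k => (hFp k).closed) hmin
    -- `u m` has colour `m` and lies in `F n` but in no earlier set, so its weight is exactly `1 /
    -- (n + 1)`.
    choose u hu huψ using fun m : ℕ => hψ n x hn _
      (inter_mem hev (Metric.ball_mem_nhds x (Nat.one_div_pos_of_nat (n := m)))) m
    have hux : Tendsto u atTop (𝓝 x) := by
      rw [tendsto_iff_dist_tendsto_zero]
      exact squeeze_zero (fun _ => dist_nonneg) (fun m => (hu m).2.2.le)
        tendsto_one_div_add_atTop_nhds_zero_nat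
    refine eq_C_of_continuousAt_eval
      (F := fun z α => oscSum A δ (H α) z + rankWeight F z * H α (ψ z))
      (δ := 1 / ((n : ℝ) + 1)) hcl hux
      (G := fun m α => oscSum A δ (H α) (u m)) (g := fun α => oscSum A δ (H α) x)
      (tendsto_pi_nhds.2 fun α => (hcontA α x hxA).tendsto.comp hux)
      Nat.one_div_pos_of_nat (fun m α => ?_) P hP
    rw [rankWeight_eq (hu m).1 (hu m).2.1, huψ]

/-! ### Algebrability -/

theorem aeval_pi_apply {ι X : Type*} (f : ι → X → ℝ) (P : MvPolynomial ι ℝ) (x : X) :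
    MvPolynomial.aeval f P x = MvPolynomial.eval (fun α => f α x) P := by
  have h := congrArg (fun φ : MvPolynomial ι ℝ →ₐ[ℝ] ℝ => φ P)
    (MvPolynomial.comp_aeval f (Pi.evalAlgHom ℝ (fun _ : X => ℝ) x))
  simpa [MvPolynomial.aeval_eq_eval] using h

theorem exists_aeval_eq_of_mem_nonUnital_adjoin {ι K A : Type*} [Field K] [CommRing A]
    [Algebra K A] {f : ι → A} {b : A} (hb : b ∈ NonUnitalAlgebra.adjoin K (range f)) :
    ∃ P : MvPolynomial ι K, MvPolynomial.constantCoeff P = 0 ∧ MvPolynomial.aeval f P = b := by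
  induction hb using NonUnitalAlgebra.adjoin_induction with
  | mem x hx =>
    obtain ⟨i, rfl⟩ := hx
    exact ⟨MvPolynomial.X i, by simp, by simp⟩
  | add x y _ _ hx hy =>
    obtain ⟨P, hP, rfl⟩ := hx
    obtain ⟨Q, hQ, rfl⟩ := hy
    exact ⟨P + Q, by simp [hP, hQ], by simp⟩
  | zero => exact ⟨0, by simp, by simp⟩
  | mul x y _ _ hx hy =>
    obtain ⟨P, hP, rfl⟩ := hx
    obtain ⟨Q, hQ, rfl⟩ := hy
    exact ⟨P * Q, by simp [hP], by simp⟩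
  | smul r x _ hx =>
    obtain ⟨P, hP, rfl⟩ := hx
    exact ⟨r • P, by simp [hP, MvPolynomial.smul_eq_C_mul], by simp⟩

/-- A family of functions continuous on `G` such that no nonconstant polynomial in them is
continuous at a point outside `G` freely generates an algebra inside `continuityClass G ∪ {0}`. -/
theorem stronglyAlgebrable_of_family {G : Set ℝ} (hne : Gᶜ.Nonempty) {f : ℝ → ℝ → ℝ}
    (hcont : ∀ α, ∀ x ∈ G, ContinuousAt (f α) x)
    (hdisc : ∀ x ∉ G, ∀ P : MvPolynomial ℝ ℝ,
      ContinuousAt (fun z => MvPolynomial.eval (fun α => f α z) P) x →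
        P = MvPolynomial.C (MvPolynomial.eval (fun α => f α x) P)) :
    StronglyAlgebrable ℝ Cardinal.continuum (continuityClass G) := by
  have hind : AlgebraicIndependent ℝ f := by
    rw [algebraicIndependent_iff]
    intro P hP
    obtain ⟨x, hx⟩ := hne
    have hz (z : ℝ) : MvPolynomial.eval (fun α => f α z) P = 0 := by
      rw [← aeval_pi_apply, hP, Pi.zero_apply]
    -- The zero function is continuous at `x`, so a relation `P` is a constant, namely `0`.
    have := hdisc x hx P (by simpa only [hz] using continuousAt_const)
    rwa [hz, map_zero] at this
  refine ⟨_, ?_, range f, ?_, rfl, fun P _ hP => ?_⟩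
  · intro b hb
    obtain ⟨P, hP0, rfl⟩ := exists_aeval_eq_of_mem_nonUnital_adjoin hb
    have hfun : MvPolynomial.aeval f P = fun z => MvPolynomial.eval (fun α => f α z) P :=
      funext (aeval_pi_apply f P)
    by_cases hP : P = 0
    · right
      simp [hP]
    left
    ext x
    rw [mem_ofPred_eq, hfun]
    refine ⟨fun h => ?_, fun hx => ?_⟩
    · by_contra hx
      have hPC := hdisc x hx P h
      refine hP ?_
      rw [hPC, MvPolynomial.constantCoeff_C] at hP0
      rw [hPC, hP0, map_zero]
    · exact (MvPolynomial.continuous_eval P).continuousAt.comp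
        (continuousAt_pi.2 fun α => hcont α x hx)
  · rw [Cardinal.mk_range_eq f hind.injective, Cardinal.mk_real]
  · exact (algebraicIndependent_iff.1 hind.coe_range) P hP

/-! ### The trace of the complement of `G` -/

theorem isOpen_countableTraceUnion (G : Set ℝ) : IsOpen (countableTraceUnion G) :=
  isOpen_sUnion fun _ h => h.1

/-- By the Lindelöf property, countably many of the open sets suffice. -/
theorem countable_countableTraceUnion_diff (G : Set ℝ) :
    (countableTraceUnion G \ G).Countable := by
  obtain ⟨T, hT, hTS, hTU⟩ := TopologicalSpace.isOpen_sUnion_countable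
    {I : Set ℝ | IsOpen I ∧ (Gᶜ ∩ I).Nonempty ∧ (Gᶜ ∩ I).Countable} fun _ h => h.1
  refine (hT.biUnion fun I hI => (hTS hI).2.2).mono ?_
  rintro x ⟨hxU, hxG⟩
  rw [countableTraceUnion, ← hTU] at hxU
  obtain ⟨I, hI, hxI⟩ := hxU
  exact mem_biUnion hI ⟨hxG, hxI⟩

/-- Otherwise, as `U \ G` is countable, a neighbourhood of `x` would have countable trace on `Gᶜ`
and lie in `U`. -/
theorem not_countable_compl_diff_countableTraceUnion_inter {G : Set ℝ} {x : ℝ}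
    (hx : x ∈ Gᶜ \ countableTraceUnion G) {V : Set ℝ} (hV : V ∈ 𝓝 x) :
    ¬ ((Gᶜ \ countableTraceUnion G) ∩ V).Countable := by
  intro hcount
  obtain ⟨I, hIV, hI, hxI⟩ := mem_nhds_iff.1 hV
  refine hx.2 ⟨I, ⟨hI, ⟨x, hx.1, hxI⟩, ?_⟩, hxI⟩
  refine (hcount.union (countable_countableTraceUnion_diff G)).mono fun y hy => ?_
  by_cases hyU : y ∈ countableTraceUnion G
  · exact Or.inr ⟨hyU, hy.1⟩
  · exact Or.inl ⟨⟨hy.1, hyU⟩, hIV hy.2⟩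

/-- The construction needs only that `G` is a `Gδ` set different from `ℝ`: points of the countable
set `countableTraceUnion G \ G` need not be isolated. -/
theorem stronglyAlgebrable_continuityClass {G : Set ℝ} (hG : IsGδ G) (hne : Gᶜ.Nonempty) :
    StronglyAlgebrable ℝ Cardinal.continuum (continuityClass G) := by
  obtain ⟨O, hO, hGO⟩ := hG.eq_iInter_nat
  let U := countableTraceUnion G
  have hE : Gᶜ \ U = ⋃ k, ((O k)ᶜ ∩ Uᶜ) := by
    rw [← iUnion_inter, ← compl_iInter, ← hGO, sdiff_eq]
  have hunion : (U \ G) ∪ (Gᶜ \ U) = Gᶜ := by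
    ext x
    by_cases hx : x ∈ U <;> simp [hx]
  obtain ⟨f, hcont, hdisc⟩ := exists_family_polynomial_discontinuous
    (countable_countableTraceUnion_diff G)
    (fun k => (hO k).isClosed_compl.inter (isOpen_countableTraceUnion G).isClosed_compl) hE
    (fun x hx V hV => not_countable_compl_diff_countableTraceUnion_inter hx hV)
    (disjoint_left.2 fun x hx hx' => hx'.2 hx.1)
  rw [hunion] at hcont hdisc
  exact stronglyAlgebrable_of_family hne (fun α x hx => hcont α x (not_not.2 hx)) hdisc

theorem mainTheorem12 (G : Set ℝ) (hG : IsGδ G)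
    (hne : (countableTraceUnion G \ G).Nonempty)
    (hdisc : IsDiscrete (countableTraceUnion G \ G)) :
    StronglyAlgebrable ℝ Cardinal.continuum (continuityClass G) := by
  exact stronglyAlgebrable_continuityClass hG (hne.mono fun _ hx => hx.2)
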